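/- **Setting.** Let $(\mathcal X,d_{\mathcal X})$ be a metric space of sensor states, $\mathcal U$ a finite set of controls, $f:\mathcal X\times\mathcal U\to\mathcal X$ the sensor motion model, $n_y\ge 1$, $A\in\mathbb R^{n_y\times n_y}$, $W\in\mathbb R^{n_y\times n_y}$ symmetric positive definite with smallest eigenvalue $\underline\lambda_W>0$, and for each $x\in\mathcal X$ let $H(x)\in\mathbb R^{n_z\times n_y}$ and let $V(x)\in\mathbb R^{n_z\times n_z}$ be symmetric positive definite. Put $M(x)=H(x)^TV(x)^{-1}H(x)$ and, for positive semidefinite $\Sigma$, $\rho_x(\Sigma)=A(I+\Sigma M(x))^{-1}\Sigma A^T+W$ (the Kalman filter Riccati map; $(I+\Sigma M)^{-1}\Sigma=(\Sigma^{-1}+M)^{-1}$ if $\Sigma$ is invertible). A node is a pair $(x,\Sigma)$; its child along $u\in\mathcal U$ is $(f(x,u),\rho_{f(x,u)}(\Sigma))$; its cost is $\log\det\Sigma$. Fix a root $(x_0,\Sigma_0)$ with $\Sigma_0\succeq 0$ and a horizon $T\ge 1$. Let $(x_t^*,\Sigma_t^*)_{t=1}^T$ be the nodes reached from the root by a control sequence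 that minimizes $\log\det\Sigma_T$ over all control sequences, and let $V_T^*=\log\det\Sigma_T^*$. **Reduced tree.** Let $\epsilon,\delta\ge0$. A matrix $\Sigma$ is $\epsilon$-algebraically redundant with respect to $\Sigma_1,\dots,\Sigma_K$ if there are $\alpha_i\ge0$ with $\sum_i\alpha_i=1$ and $\Sigma+\epsilon I\succeq\sum_i\alpha_i\Sigma_i$. An $(\epsilon,\delta)$-reduced tree has levels $S_0=\{(x_0,\Sigma_0)\},S_1,\dots,S_T$, where $S_{t+1}$ arises from the set of all children of the nodes in $S_t$ by removing nodes such that each removed node $(x,\Sigma)$ is $\epsilon$-algebraically redundant with respect to the covariances $\Sigma^i$ of finitely many retained nodes $(x^i,\Sigma^i)\in S_{t+1}$ that $\delta$-cross it, i.e. $d_{\mathcal X}(x,x^i)\le\delta$. Let $V_T^{\epsilon,\delta}$ be the minimum of $\log\det\Sigma$ over $(x,\Sigma)\in S_T$. **Assumptions.** There are constants $L_f,L_m\ge0$ such that for all $u\in\mathcal U$ and $x_1,x_2\in\mathcal X$: $d_{\mathcal X}(f(x_1,u),f(x_2,u))\le L_f\,d_{\mathcal X}(x_1,x_2)$, $M(x_1)\preceq(1+L_m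 d_{\mathcal X}(x_1,x_2))M(x_2)$ and $M(x_2)\preceq(1+L_m d_{\mathcal X}(x_1,x_2))M(x_1)$. Moreover $\beta_*<\infty$ satisfies $\Sigma_t^*\preceq\beta_*I$ for all $t\in\{1,\dots,T\}$. **Theorem.** For every $(\epsilon,\delta)$-reduced tree the minimum $V_T^{\epsilon,\delta}$ exists and $$0\le V_T^{\epsilon,\delta}-V_T^*\le(\zeta_T-1)\bigl[V_T^*-\log\det W\bigr]+\epsilon\,\Delta_T,$$ where $$\zeta_t=\prod_{\tau=1}^{t-1}\Bigl(1+\sum_{s=1}^{\tau}L_f^sL_m\delta\Bigr)\ge1\ (1\le t\le T),\qquad \eta_*=\frac{\beta_*}{\beta_*+\underline\lambda_W}<1,$$ $$\Delta_T=\frac{n_y}{\underline\lambda_W}\Bigl(1+\frac{\beta_*}{\underline\lambda_W}\sum_{\tau=1}^{T-1}\frac{\zeta_T}{\zeta_\tau}\,\eta_*^{T-\tau}\Bigr).$$ -/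

import Mathlib

namespace InfoAcq

/-- A sensing robot tracking a target under linear Gaussian assumptions.  `X` is the space of sensor
states, `U` the set of admissible controls, `n` and `m` the dimensions of the target state and of the
measurement.  Sensor motion: `x' = f x u`; target motion: `y' = A y + w` with `w ~ N(0, W)`;
observation: `z = H x y + v` with `v ~ N(0, V x)`. -/
structure SensingModel (X U : Type*) (n m : ℕ) where
  /-- sensor motion model -/
  f : X → U → X
  /-- target motion matrix -/
  A : Matrix (Fin n) (Fin n) ℝ
  /-- covariance of the target noise -/
  W : Matrix (Fin n) (Fin n) ℝ
  /-- observation matrix -/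
  H : X → Matrix (Fin m) (Fin n) ℝ
  /-- covariance of the measurement noise -/
  V : X → Matrix (Fin m) (Fin m) ℝ
  W_posDef : W.PosDef
  V_posDef : ∀ x, (V x).PosDef

/-- A node of the search tree: a sensor state together with a target covariance. -/
abbrev Node (X : Type*) (n : ℕ) : Type _ := X × Matrix (Fin n) (Fin n) ℝ

/-- The cost of a node, `log det Σ`. -/
noncomputable def cost {X : Type*} {n : ℕ} (p : Node X n) : ℝ := Real.log p.2.det

namespace SensingModel

variable {X U : Type*} {n m : ℕ}

/-- The sensor information matrix `M(x) = H(x)ᵀ V(x)⁻¹ H(x)`. -/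
noncomputable def infoMatrix (S : SensingModel X U n m) (x : X) : Matrix (Fin n) (Fin n) ℝ :=
  (S.H x).transpose * (S.V x)⁻¹ * S.H x

/-- The Kalman update `C Σ` with `C = (I + Σ M(x))⁻¹`.  For invertible `Σ` this is
`(Σ⁻¹ + M(x))⁻¹`; the present form is also meaningful for singular positive semidefinite `Σ`. -/
noncomputable def update (S : SensingModel X U n m) (x : X) (P : Matrix (Fin n) (Fin n) ℝ) :
    Matrix (Fin n) (Fin n) ℝ :=
  (1 + P * S.infoMatrix x)⁻¹ * P

theorem update_eq (S : SensingModel X U n m) (x : X) (P : Matrix (Fin n) (Fin n) ℝ)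
    (hP : P.PosDef) : S.update x P = (P⁻¹ + S.infoMatrix x)⁻¹ := by
  have hu : IsUnit P.det := (Matrix.isUnit_iff_isUnit_det P).1 hP.isUnit
  have h : P⁻¹ + S.infoMatrix x = P⁻¹ * (1 + P * S.infoMatrix x) := by
    rw [Matrix.mul_add, Matrix.mul_one, Matrix.nonsing_inv_mul_cancel_left _ _ hu]
  rw [h, Matrix.mul_inv_rev, Matrix.nonsing_inv_nonsing_inv _ hu, update]

/-- The Kalman filter Riccati map at the sensor state `x`: update, then predict. -/
noncomputable def riccati (S : SensingModel X U n m) (x : X) (P : Matrix (Fin n) (Fin n) ℝ) :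
    Matrix (Fin n) (Fin n) ℝ :=
  S.A * S.update x P * S.A.transpose + S.W

/-- The child of a node along the control `u`. -/
noncomputable def step (S : SensingModel X U n m) (p : Node X n) (u : U) : Node X n :=
  (S.f p.1 u, S.riccati (S.f p.1 u) p.2)

/-- The node reached at time `t` from the root by the control sequence `σ 0, σ 1, …`. -/
noncomputable def node (S : SensingModel X U n m) (root : Node X n) (σ : ℕ → U) : ℕ → Node X n
  | 0 => root
  | t + 1 => S.step (node S root σ t) (σ t)

/-- The control sequence `σ` (of which only the entries before `T` matter) minimizes `log det Σ_T`
among all control sequences. -/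
def IsOptimal (S : SensingModel X U n m) (root : Node X n) (T : ℕ) (σ : ℕ → U) : Prop :=
  ∀ σ' : ℕ → U, cost (S.node root σ T) ≤ cost (S.node root σ' T)

/-- All the children of the nodes in `N`. -/
def expand (S : SensingModel X U n m) (N : Set (Node X n)) : Set (Node X n) :=
  {q | ∃ p ∈ N, ∃ u : U, q = S.step p u}

/-- The smallest eigenvalue of `W` (a minimum whenever `0 < n`). -/
noncomputable def lambdaW (S : SensingModel X U n m) : ℝ :=
  ⨅ i, S.W_posDef.isHermitian.eigenvalues i

end SensingModel

/-- `P` is `ε`-algebraically redundant with respect to the matrices `Q 0, …, Q (K - 1)`: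
`P + ε I` dominates some convex combination of them in the Loewner order. -/
def EpsAlgRedundant {n : ℕ} (ε : ℝ) (P : Matrix (Fin n) (Fin n) ℝ) {K : ℕ}
    (Q : Fin K → Matrix (Fin n) (Fin n) ℝ) : Prop :=
  ∃ α : Fin K → ℝ, (∀ i, 0 ≤ α i) ∧ ∑ i, α i = 1 ∧
    (P + ε • (1 : Matrix (Fin n) (Fin n) ℝ) - ∑ i, α i • Q i).PosSemidef

/-- `R` is obtained from the level `N` of a search tree by removing `ε`-algebraically redundant
`δ`-crossing nodes: each removed node is `ε`-algebraically redundant with respect to finitely many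
retained nodes, all of whose sensor states are within `δ` of its own.  Neither the order in which the
nodes are examined nor the presence of further removable nodes is prescribed. -/
def IsPruning {X : Type*} [MetricSpace X] {n : ℕ} (ε δ : ℝ) (N R : Set (Node X n)) : Prop :=
  R ⊆ N ∧ ∀ p ∈ N \ R, ∃ (K : ℕ) (q : Fin K → Node X n),
    (∀ i, q i ∈ R ∧ dist p.1 (q i).1 ≤ δ) ∧ EpsAlgRedundant ε p.2 (fun i => (q i).2)

/-- `L 0, …, L T` are the levels of an `(ε, δ)`-reduced search tree: the root alone at level `0`, and
each further level obtained by expanding the previous (reduced) level with all the controls and then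
pruning. -/
def IsReducedTree {X U : Type*} [MetricSpace X] {n m : ℕ} (S : SensingModel X U n m)
    (root : Node X n) (T : ℕ) (ε δ : ℝ) (L : ℕ → Set (Node X n)) : Prop :=
  L 0 = {root} ∧ ∀ t < T, IsPruning ε δ (S.expand (L t)) (L (t + 1))

/-- `V` is the value found by searching the last level of a tree: the least cost of its nodes. -/
def IsTreeValue {X : Type*} {n : ℕ} (N : Set (Node X n)) (V : ℝ) : Prop :=
  IsLeast (cost '' N) V

/-- Motion model continuity with constant `Lf`. -/
def MotionContinuity {X U : Type*} [MetricSpace X] {n m : ℕ} (S : SensingModel X U n m)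
    (Lf : ℝ) : Prop :=
  0 ≤ Lf ∧ ∀ (u : U) (x₁ x₂ : X), dist (S.f x₁ u) (S.f x₂ u) ≤ Lf * dist x₁ x₂

/-- Observation model continuity with constant `Lm` (inequalities in the Loewner order). -/
def ObservationContinuity {X U : Type*} [MetricSpace X] {n m : ℕ} (S : SensingModel X U n m)
    (Lm : ℝ) : Prop :=
  0 ≤ Lm ∧ ∀ x₁ x₂ : X,
    ((1 + Lm * dist x₁ x₂) • S.infoMatrix x₂ - S.infoMatrix x₁).PosSemidef ∧
    ((1 + Lm * dist x₁ x₂) • S.infoMatrix x₁ - S.infoMatrix x₂).PosSemidef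

/-- `ζ_t = ∏_{τ=1}^{t-1} (1 + ∑_{s=1}^{τ} Lf ^ s Lm δ)`. -/
noncomputable def zeta (Lf Lm δ : ℝ) (t : ℕ) : ℝ :=
  ∏ τ ∈ Finset.Ico 1 t, (1 + ∑ s ∈ Finset.Icc 1 τ, Lf ^ s * Lm * δ)

/-- `η = β / (β + lam)`. -/
noncomputable def eta (β lam : ℝ) : ℝ := β / (β + lam)

/-- `Δ_T = (n / lam) (1 + (β / lam) ∑_{τ=1}^{T-1} (ζ_T / ζ_τ) η ^ (T - τ))`. -/
noncomputable def Delta (n : ℕ) (lam β Lf Lm δ : ℝ) (T : ℕ) : ℝ :=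
  (n / lam) * (1 + (β / lam) *
    ∑ τ ∈ Finset.Ico 1 T, (zeta Lf Lm δ T / zeta Lf Lm δ τ) * eta β lam ^ (T - τ))

end InfoAcq

/-! Follow the optimal trajectory `(x_t, B_t)`. The invariant is that level `t` keeps, within `D_t =
∑_{s<t} Lf ^ s * δ` of `x_t`, nodes some convex combination of whose covariances is at most `W + ζ_t
(B_t - W) + ε (1 + k_t B_t)`, with `k_t` given by `errorGain`
(`IsReducedTree.exists_convexHull_le`). Pruning adds `δ` to the radius and `ε I` to the bound. For
expansion, the gain that is optimal at `B_t` is frozen and used at every nearby node. With a fixed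
gain the Joseph form is affine in the covariance, so it respects convex combinations, and it
dominates each true update up to the factor `1 + Lm * Lf * D_t` that pays for the different sensor
state (`update_le_gain`). The outcome is a multiple of `B_{t+1} - W`, plus `W`; since `B_{t+1} - W ≤
η B_{t+1}`, old errors are discounted (`sub_noise_le_eta`). At time `T`, `log det` is concave: its
tangent is linear on covariances, so some single node does no worse than the convex combination
(`exists_log_det_le`). -/

namespace InfoAcq

/-! ### Loewner order, traces and concavity of `log det`. -/

section LoewnerOrder

open scoped MatrixOrder
open Matrix

variable {n m : ℕ}

theorem conj_mono (C : Matrix (Fin m) (Fin n) ℝ) {P Q : Matrix (Fin n) (Fin n) ℝ} (h : P ≤ Q) :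
    C * P * Cᵀ ≤ C * Q * Cᵀ := by
  have := (Matrix.le_iff.1 h).mul_mul_conjTranspose_same C
  rw [conjTranspose_eq_transpose_of_trivial, Matrix.mul_sub, Matrix.sub_mul] at this
  exact this

theorem conj_nonneg (C : Matrix (Fin m) (Fin n) ℝ) {P : Matrix (Fin n) (Fin n) ℝ} (h : 0 ≤ P) :
    0 ≤ C * P * Cᵀ := by
  simpa using conj_mono C h

theorem smul_one_mono {a b : ℝ} (h : a ≤ b) :
    a • (1 : Matrix (Fin n) (Fin n) ℝ) ≤ b • 1 := by
  rw [Matrix.le_iff, ← sub_smul]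
  exact PosSemidef.one.smul (sub_nonneg.2 h)

theorem smul_mono {a : ℝ} (ha : 0 ≤ a) {P Q : Matrix (Fin n) (Fin n) ℝ} (h : P ≤ Q) :
    a • P ≤ a • Q := by
  rw [Matrix.le_iff, ← smul_sub]
  exact (Matrix.le_iff.1 h).smul ha

theorem smul_psd_nonneg {a : ℝ} (ha : 0 ≤ a) {P : Matrix (Fin n) (Fin n) ℝ} (h : 0 ≤ P) :
    0 ≤ a • P := by
  simpa using smul_mono ha h

theorem posDef_of_le {P Q : Matrix (Fin n) (Fin n) ℝ} (hP : P.PosDef) (h : P ≤ Q) : Q.PosDef := by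
  simpa using hP.add_posSemidef (Matrix.le_iff.1 h)

theorem transpose_eq_of_nonneg {P : Matrix (Fin n) (Fin n) ℝ} (h : 0 ≤ P) : Pᵀ = P := by
  have := (Matrix.nonneg_iff_posSemidef.1 h).isHermitian
  rwa [IsHermitian, conjTranspose_eq_transpose_of_trivial] at this

/-- Factoring `P = B* B` and cycling the determinant turns `1 + P * M` into `1 + B M B*`, which is
positive definite. -/
theorem isUnit_det_one_add_mul {P M : Matrix (Fin n) (Fin n) ℝ} (hP : 0 ≤ P) (hM : 0 ≤ M) :
    IsUnit (1 + P * M).det := by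
  obtain ⟨B, rfl⟩ := CStarAlgebra.nonneg_iff_eq_star_mul_self.1 hP
  rw [Matrix.mul_assoc, Matrix.det_one_add_mul_comm]
  have h := (Matrix.nonneg_iff_posSemidef.1 hM).mul_mul_conjTranspose_same B
  exact (PosDef.one.add_posSemidef h).det_pos.ne'.isUnit

/-- Concavity of `log det`: with `P⁻¹ = B* B`, apply `log x ≤ x - 1` to each eigenvalue of `B Q B*`.
-/
theorem log_det_le_tangent {P Q : Matrix (Fin n) (Fin n) ℝ} (hP : P.PosDef) (hQ : Q.PosDef) :
    Real.log Q.det ≤ Real.log P.det + (P⁻¹ * Q).trace - n := by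
  have hPi := hP.inv
  obtain ⟨B, hB⟩ := CStarAlgebra.nonneg_iff_eq_star_mul_self.1
    (Matrix.nonneg_iff_posSemidef.2 hPi.posSemidef)
  rw [star_eq_conjTranspose] at hB
  have hdet : (B * Q * Bᴴ).det = P.det⁻¹ * Q.det := by
    have : P.det⁻¹ = Bᴴ.det * B.det := by
      rw [← det_mul, ← hB, det_nonsing_inv, Ring.inverse_eq_inv']
    rw [this, det_mul, det_mul]; ring
  have htr : (B * Q * Bᴴ).trace = (P⁻¹ * Q).trace := by
    rw [hB, trace_mul_comm, ← Matrix.mul_assoc]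
  have hps := hQ.posSemidef.mul_mul_conjTranspose_same B
  have hN : (B * Q * Bᴴ).PosDef := by
    rw [hps.posDef_iff_det_ne_zero, hdet]
    exact mul_ne_zero (inv_ne_zero hP.det_pos.ne') hQ.det_pos.ne'
  have h1 : Real.log (B * Q * Bᴴ).det ≤ (B * Q * Bᴴ).trace - n := by
    rw [hN.isHermitian.det_eq_prod_eigenvalues, hN.isHermitian.trace_eq_sum_eigenvalues]
    simp only [RCLike.ofReal_real_eq_id, id]
    rw [Real.log_prod (fun i _ => (hN.eigenvalues_pos i).ne')]
    calc _ ≤ ∑ i, (hN.isHermitian.eigenvalues i - 1) :=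
          Finset.sum_le_sum fun i _ => Real.log_le_sub_one_of_pos (hN.eigenvalues_pos i)
      _ = _ := by simp
  rw [hdet, htr, Real.log_mul (inv_ne_zero hP.det_pos.ne') hQ.det_pos.ne', Real.log_inv] at h1
  linarith

theorem trace_mul_nonneg {P Q : Matrix (Fin n) (Fin n) ℝ} (hP : 0 ≤ P) (hQ : 0 ≤ Q) :
    0 ≤ (P * Q).trace := by
  obtain ⟨B, rfl⟩ := CStarAlgebra.nonneg_iff_eq_star_mul_self.1 hP
  rw [Matrix.mul_assoc, trace_mul_comm, Matrix.mul_assoc, ← Matrix.mul_assoc]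
  exact ((Matrix.nonneg_iff_posSemidef.1 hQ).mul_mul_conjTranspose_same B).trace_nonneg

theorem trace_mul_mono {P Q R : Matrix (Fin n) (Fin n) ℝ} (hP : 0 ≤ P) (h : Q ≤ R) :
    (P * Q).trace ≤ (P * R).trace := by
  have := trace_mul_nonneg hP (sub_nonneg.2 h)
  rw [Matrix.mul_sub, trace_sub] at this
  linarith

/-- Along the segment from `W` through `B`, `log det` grows at most linearly beyond `B`. -/
theorem log_det_extrapolate {W B : Matrix (Fin n) (Fin n) ℝ} (hW : W.PosDef) (hWB : W ≤ B)
    {z : ℝ} (hz : 1 ≤ z) :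
    Real.log (W + z • (B - W)).det - Real.log B.det ≤
      (z - 1) * (Real.log B.det - Real.log W.det) := by
  have hB := posDef_of_le hW hWB
  have hQ : (W + z • (B - W)).PosDef :=
    hW.add_posSemidef ((Matrix.le_iff.1 hWB).smul (by linarith))
  have h1 := log_det_le_tangent hB hQ
  -- The weight `z - 1` cancels the `tr (B⁻¹ W)` term of `h1`.
  have h2 := mul_le_mul_of_nonneg_left (log_det_le_tangent hB hW) (sub_nonneg.2 hz)
  have h3 : (B⁻¹ * (W + z • (B - W))).trace = z * n - (z - 1) * (B⁻¹ * W).trace := by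
    rw [Matrix.mul_add, Matrix.mul_smul, Matrix.mul_sub,
      nonsing_inv_mul _ hB.det_pos.ne'.isUnit, trace_add, trace_smul, trace_sub, trace_one]
    simp only [Fintype.card_fin, smul_eq_mul]; ring
  rw [h3] at h1
  nlinarith

/-- With `t = tr Q⁻¹` and `q = tr Q⁻²`, the two squares below give `l q ≤ t` and `2 l t ≤ n + l² q`;
eliminate `q`. -/
theorem trace_inv_le {Q : Matrix (Fin n) (Fin n) ℝ} {l : ℝ} (hl : 0 < l)
    (h : l • (1 : Matrix (Fin n) (Fin n) ℝ) ≤ Q) : Q⁻¹.trace ≤ n / l := by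
  have hQ : Q.PosDef := posDef_of_le (PosDef.one.smul hl) h
  have hs : Q⁻¹ᵀ = Q⁻¹ :=
    transpose_eq_of_nonneg (Matrix.nonneg_iff_posSemidef.2 hQ.inv.posSemidef)
  have h1 := (Matrix.nonneg_iff_posSemidef.1 (conj_nonneg Q⁻¹ (sub_nonneg.2 h))).trace_nonneg
  have h2 := (Matrix.nonneg_iff_posSemidef.1
    (conj_nonneg (1 - l • Q⁻¹) (zero_le_one (α := Matrix (Fin n) (Fin n) ℝ)))).trace_nonneg
  simp only [hs, Matrix.mul_sub, Matrix.sub_mul, nonsing_inv_mul _ hQ.det_pos.ne'.isUnit,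
    Matrix.mul_smul, Matrix.smul_mul, Matrix.one_mul, Matrix.mul_one, transpose_sub, transpose_one,
    transpose_smul, trace_sub, trace_smul, trace_one, smul_eq_mul, Fintype.card_fin] at h1 h2
  rw [le_div_iff₀ hl]
  nlinarith

theorem iInf_eigenvalues_smul_le {W : Matrix (Fin n) (Fin n) ℝ} (hW : W.IsHermitian) :
    (⨅ i, hW.eigenvalues i) • (1 : Matrix (Fin n) (Fin n) ℝ) ≤ W := by
  rw [Matrix.le_iff, posSemidef_iff_isHermitian_and_spectrum_nonneg]
  refine ⟨hW.sub (by simp [IsHermitian]), ?_⟩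
  rw [← Algebra.algebraMap_eq_smul_one, ← spectrum.sub_singleton_eq,
    hW.spectrum_real_eq_range_eigenvalues]
  rintro _ ⟨_, ⟨i, rfl⟩, _, rfl, rfl⟩
  exact sub_nonneg.2 (ciInf_le (f := hW.eigenvalues) (Set.finite_range _).bddBelow i)

/-- Reduces domination by a convex hull to its generators, through `convexHull_min`. Both pruning
and expansion are handled this way. -/
theorem convex_exists_le {s : Set (Matrix (Fin n) (Fin n) ℝ)} (hs : Convex ℝ s)
    (g : Matrix (Fin n) (Fin n) ℝ →ᵃ[ℝ] Matrix (Fin n) (Fin n) ℝ) :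
    Convex ℝ {Q | ∃ R ∈ s, R ≤ g Q} := by
  rintro P ⟨P', hP', hP⟩ Q ⟨Q', hQ', hQ⟩ a b ha hb hab
  refine ⟨a • P' + b • Q', hs hP' hQ' ha hb hab, ?_⟩
  rw [Convex.combo_affine_apply hab]
  exact add_le_add (smul_mono ha hP) (smul_mono hb hQ)

/-- A matrix in a convex hull is dominated, in the tangent upper bound for `log det`, by one of the
generators. -/
theorem exists_log_det_le {s : Set (Matrix (Fin n) (Fin n) ℝ)} (hs : ∀ Q ∈ s, Q.PosDef)
    {P Q Z : Matrix (Fin n) (Fin n) ℝ} (hP : P.PosDef) (hQ : Q ∈ convexHull ℝ s) (hQZ : Q ≤ Z) :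
    ∃ R ∈ s, Real.log R.det ≤ Real.log P.det + (P⁻¹ * (Z - P)).trace := by
  have hP0 : 0 ≤ P⁻¹ := Matrix.nonneg_iff_posSemidef.2 hP.inv.posSemidef
  have key : ∃ R ∈ s, (P⁻¹ * R).trace ≤ (P⁻¹ * Z).trace := by
    -- Otherwise all generators, hence their hull, lie in one open half-space that excludes `Q`.
    by_contra! hcon
    have hc : Convex ℝ {R : Matrix (Fin n) (Fin n) ℝ | (P⁻¹ * Z).trace < (P⁻¹ * R).trace} :=
      convex_halfSpace_gt (𝕜 := ℝ) (f := fun R : Matrix (Fin n) (Fin n) ℝ => (P⁻¹ * R).trace)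
        ⟨fun x y => by simp [Matrix.mul_add], fun c x => by simp⟩ _
    exact absurd (convexHull_min hcon hc hQ) (not_lt.2 (trace_mul_mono hP0 hQZ))
  obtain ⟨R, hR, h⟩ := key
  refine ⟨R, hR, (log_det_le_tangent hP (hs R hR)).trans ?_⟩
  rw [Matrix.mul_sub, trace_sub, nonsing_inv_mul _ hP.det_pos.ne'.isUnit, trace_one,
    Fintype.card_fin]
  linarith

end LoewnerOrder


/-! ### The Kalman update under a suboptimal gain. -/

section KalmanUpdate

open scoped MatrixOrder
open Matrix

variable {n : ℕ}

theorem mul_inv_one_add_comm {P M : Matrix (Fin n) (Fin n) ℝ} (hP : 0 ≤ P) (hM : 0 ≤ M) :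
    P * (1 + P * M)⁻¹ᵀ = (1 + P * M)⁻¹ * P := by
  have hu := isUnit_det_one_add_mul hP hM
  have hD : (1 + P * M)⁻¹ᵀ = (1 + M * P)⁻¹ := by
    rw [transpose_nonsing_inv, transpose_add, transpose_mul, transpose_one,
      transpose_eq_of_nonneg hP, transpose_eq_of_nonneg hM]
  have hu' := isUnit_det_one_add_mul hM hP
  have h : (1 + P * M) * P = P * (1 + M * P) := by noncomm_ring
  rw [hD]
  calc P * (1 + M * P)⁻¹ = (1 + P * M)⁻¹ * ((1 + P * M) * P) * (1 + M * P)⁻¹ := by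
        rw [nonsing_inv_mul_cancel_left _ _ hu]
    _ = (1 + P * M)⁻¹ * P := by
        rw [h, ← Matrix.mul_assoc, mul_nonsing_inv_cancel_right _ _ hu']

/-- Joseph form of the covariance update. -/
theorem joseph_form {P M : Matrix (Fin n) (Fin n) ℝ} (hP : 0 ≤ P) (hM : 0 ≤ M) :
    (1 + P * M)⁻¹ * P * (1 + P * M)⁻¹ᵀ +
      (1 + P * M)⁻¹ * P * M * ((1 + P * M)⁻¹ * P)ᵀ = (1 + P * M)⁻¹ * P := by
  have hu := isUnit_det_one_add_mul hP hM
  rw [transpose_mul, transpose_eq_of_nonneg hP]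
  have h1 : (1 + P * M)⁻¹ * P * (1 + P * M)⁻¹ᵀ
      + (1 + P * M)⁻¹ * P * M * (P * (1 + P * M)⁻¹ᵀ)
      = (1 + P * M)⁻¹ * (1 + P * M) * (P * (1 + P * M)⁻¹ᵀ) := by noncomm_ring
  rw [h1, nonsing_inv_mul _ hu, Matrix.one_mul, mul_inv_one_add_comm hP hM]

theorem one_sub_update_mul {P M : Matrix (Fin n) (Fin n) ℝ} (hP : 0 ≤ P) (hM : 0 ≤ M) :
    1 - (1 + P * M)⁻¹ * P * M = (1 + P * M)⁻¹ := by
  have hu := isUnit_det_one_add_mul hP hM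
  have h : (1 + P * M)⁻¹ * (1 + P * M) = 1 := nonsing_inv_mul _ hu
  rw [Matrix.mul_add, Matrix.mul_one, ← Matrix.mul_assoc] at h
  rw [sub_eq_iff_eq_add, h]

theorem update_nonneg {P M : Matrix (Fin n) (Fin n) ℝ} (hP : 0 ≤ P) (hM : 0 ≤ M) :
    0 ≤ (1 + P * M)⁻¹ * P := by
  rw [← joseph_form hP hM]
  exact add_nonneg (conj_nonneg _ hP) (conj_nonneg _ hM)

/-- Suboptimality of an arbitrary gain `G` for a smaller information matrix `M`. -/
theorem update_le_gain {Q M M' : Matrix (Fin n) (Fin n) ℝ} (hQ : 0 ≤ Q) (hM : 0 ≤ M) (hM' : 0 ≤ M')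
    {c : ℝ} (hc : 1 ≤ c) (hMM : M ≤ c • M') (G : Matrix (Fin n) (Fin n) ℝ) :
    (1 + Q * M')⁻¹ * Q ≤ c • ((1 - G * M) * Q * (1 - G * M)ᵀ + G * M * Gᵀ) := by
  have hc0 : 0 < c := by linarith
  have hS0 := update_nonneg hQ hM'
  have hj := joseph_form hQ hM'
  have hcomm := mul_inv_one_add_comm hQ hM'
  have hSt := transpose_eq_of_nonneg hS0
  have hMt := transpose_eq_of_nonneg hM
  generalize hD : (1 + Q * M')⁻¹ = D at *
  generalize hS : D * Q = S at *
  rw [hSt] at hj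
  -- Completing the square: the four nonnegative terms `t1`, …, `t4` sum exactly to the right side
  -- minus the left.
  have t1 := smul_psd_nonneg hc0.le (conj_nonneg ((1 - G * M) - c⁻¹ • D) hQ)
  have t2 := smul_psd_nonneg hc0.le (conj_nonneg (G - c⁻¹ • S) hM)
  have t3 := smul_psd_nonneg (sub_nonneg.2 (inv_le_one_of_one_le₀ hc)) (conj_nonneg D hQ)
  have t4 := smul_psd_nonneg (inv_nonneg.2 hc0.le) (conj_nonneg S (sub_nonneg.2 hMM))
  rw [← sub_nonneg]
  refine (add_nonneg (add_nonneg (add_nonneg t1 t2) t3) t4).trans_eq ?_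
  have e (N D Q : Matrix (Fin n) (Fin n) ℝ) (r : ℝ) :
      (N - r • D) * Q * (N - r • D)ᵀ =
        N * Q * Nᵀ - r • (N * (Q * Dᵀ)) - r • (D * Q * Nᵀ) + (r * r) • (D * Q * Dᵀ) := by
    simp only [transpose_sub, transpose_smul, Matrix.sub_mul, Matrix.mul_sub, Matrix.smul_mul,
      Matrix.mul_smul, Matrix.mul_assoc]
    module
  have h1 : (1 - G * M) * S = S - G * (M * S) := by
    rw [Matrix.sub_mul, Matrix.one_mul, Matrix.mul_assoc]
  have h2 : S * (1 - G * M)ᵀ = S - S * M * Gᵀ := by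
    rw [transpose_sub, transpose_mul, hMt, transpose_one, Matrix.mul_sub, Matrix.mul_one,
      ← Matrix.mul_assoc]
  have h3 : S * (c • M' - M) * S = c • (S - S * Dᵀ) - S * M * S := by
    rw [Matrix.mul_sub, Matrix.sub_mul, Matrix.mul_smul, Matrix.smul_mul, eq_sub_of_add_eq' hj]
  rw [e, e, hSt, hcomm, hS, h1, h2, h3]
  match_scalars <;> field_simp <;> ring

/-- The gain-bounded Riccati step applied to an inflated covariance. -/
theorem gain_step_le {B M Z : Matrix (Fin n) (Fin n) ℝ} (hB : 0 ≤ B) (hM : 0 ≤ M) {g c : ℝ}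
    (hg : 1 ≤ g) (hc : 0 ≤ c) (hZ : Z ≤ g • B) (A G : Matrix (Fin n) (Fin n) ℝ)
    (hG : G = (1 + B * M)⁻¹ * B) :
    c • (A * ((1 - G * M) * Z * (1 - G * M)ᵀ + G * M * Gᵀ) * Aᵀ) ≤ (c * g) • (A * G * Aᵀ) := by
  have hj := joseph_form hB hM
  rw [← hG] at hj
  have h1 : 1 - G * M = (1 + B * M)⁻¹ := by rw [hG, one_sub_update_mul hB hM]
  have key : (1 - G * M) * Z * (1 - G * M)ᵀ + G * M * Gᵀ ≤ g • G := by
    have h2 : g • G = g • ((1 + B * M)⁻¹ * B * (1 + B * M)⁻¹ᵀ) + g • (G * M * Gᵀ) := by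
      rw [← smul_add, ← hG, hj]
    have h3 := conj_mono (1 + B * M)⁻¹ hZ
    rw [Matrix.mul_smul, Matrix.smul_mul] at h3
    -- The measurement noise term is not inflated by `Z`, so `1 ≤ g` absorbs it.
    have h4 := smul_psd_nonneg (sub_nonneg.2 hg) (conj_nonneg G hM)
    rw [sub_smul, one_smul, sub_nonneg] at h4
    rw [h1, h2]
    exact add_le_add h3 h4
  have h5 := smul_mono hc (conj_mono A key)
  rwa [Matrix.mul_smul, Matrix.smul_mul, smul_smul] at h5

/-- The noise is a definite fraction of the covariance: `W ≥ l I ≥ (l / (b + l)) B`. This is the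
contraction behind the powers of `η`. -/
theorem sub_noise_le_eta {W B : Matrix (Fin n) (Fin n) ℝ} {l b : ℝ} (hl : 0 < l) (hb : 0 < b)
    (hW : l • (1 : Matrix (Fin n) (Fin n) ℝ) ≤ W) (hB : B ≤ b • (1 : Matrix (Fin n) (Fin n) ℝ)) :
    B - W ≤ eta b l • B := by
  have h1 : (1 - eta b l) = l / (b + l) := by
    rw [eta]; field_simp; ring
  have h2 : (l / (b + l)) • B ≤ W := by
    refine (smul_mono (by positivity) hB).trans (le_trans ?_ hW)
    rw [smul_smul]
    apply smul_one_mono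
    rw [div_mul_eq_mul_div, div_le_iff₀ (by positivity)]
    nlinarith
  rw [← h1, sub_smul, one_smul] at h2
  exact sub_le_comm.1 h2

end KalmanUpdate


/-! ### Recursions for the constants. -/

section Constants

/-- Identifies the factor of `ζ` as `1 + Lm * (Lf * D_t)`, the observation mismatch after one motion
step from radius `D_t`. -/
theorem sum_Icc_pow_eq (Lf Lm δ : ℝ) (t : ℕ) :
    ∑ s ∈ Finset.Icc 1 t, Lf ^ s * Lm * δ =
      Lm * (Lf * ∑ s ∈ Finset.range t, Lf ^ s * δ) := by
  induction t with
  | zero => simp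
  | succ t ih =>
    rw [Finset.sum_Icc_succ_top (by omega), ih, Finset.sum_range_succ]
    ring

/-- Growth of the radius: motion scales it by `Lf`, pruning adds `δ`. -/
theorem sum_range_pow_succ (Lf δ : ℝ) (t : ℕ) :
    ∑ s ∈ Finset.range (t + 1), Lf ^ s * δ =
      Lf * (∑ s ∈ Finset.range t, Lf ^ s * δ) + δ := by
  rw [Finset.sum_range_succ', Finset.mul_sum]
  simp only [pow_succ, pow_zero, one_mul]
  congr 1
  exact Finset.sum_congr rfl fun s _ => by ring

theorem one_le_zeta_factor {Lf Lm δ : ℝ} (hLf : 0 ≤ Lf) (hLm : 0 ≤ Lm) (hδ : 0 ≤ δ) (t : ℕ) :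
    1 ≤ 1 + ∑ s ∈ Finset.Icc 1 t, Lf ^ s * Lm * δ :=
  le_add_of_nonneg_right (Finset.sum_nonneg fun _ _ => by positivity)

theorem one_le_zeta {Lf Lm δ : ℝ} (hLf : 0 ≤ Lf) (hLm : 0 ≤ Lm) (hδ : 0 ≤ δ) (t : ℕ) :
    1 ≤ zeta Lf Lm δ t := by
  rw [zeta]
  exact Finset.prod_induction _ (1 ≤ ·) (fun _ _ => one_le_mul_of_one_le_of_one_le) le_rfl
    fun τ _ => one_le_zeta_factor hLf hLm hδ τ

theorem zeta_succ (Lf Lm δ : ℝ) {t : ℕ} (ht : 1 ≤ t) :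
    zeta Lf Lm δ (t + 1) =
      (1 + ∑ s ∈ Finset.Icc 1 t, Lf ^ s * Lm * δ) * zeta Lf Lm δ t := by
  rw [zeta, Finset.prod_Ico_succ_top ht, mul_comm, zeta]

/-- The accumulated weight of past redundancy errors, relative to the optimal covariance. -/
noncomputable def errorGain (lam β Lf Lm δ : ℝ) (t : ℕ) : ℝ :=
  (1 / lam) * ∑ τ ∈ Finset.Ico 1 t, (zeta Lf Lm δ t / zeta Lf Lm δ τ) * eta β lam ^ (t - τ)

theorem errorGain_succ {lam β Lf Lm δ : ℝ} (hLf : 0 ≤ Lf) (hLm : 0 ≤ Lm) (hδ : 0 ≤ δ)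
    {t : ℕ} (ht : 1 ≤ t) :
    errorGain lam β Lf Lm δ (t + 1) =
      (1 + ∑ s ∈ Finset.Icc 1 t, Lf ^ s * Lm * δ) *
        ((1 / lam + errorGain lam β Lf Lm δ t) * eta β lam) := by
  have hz : zeta Lf Lm δ t ≠ 0 := (one_pos.trans_le (one_le_zeta hLf hLm hδ t)).ne'
  have h : ∀ τ ∈ Finset.Ico 1 t,
      zeta Lf Lm δ (t + 1) / zeta Lf Lm δ τ * eta β lam ^ (t + 1 - τ) =
      ((1 + ∑ s ∈ Finset.Icc 1 t, Lf ^ s * Lm * δ) * eta β lam) *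
        (zeta Lf Lm δ t / zeta Lf Lm δ τ * eta β lam ^ (t - τ)) := by
    intro τ hτ
    rw [Finset.mem_Ico] at hτ
    rw [zeta_succ Lf Lm δ ht, Nat.succ_sub hτ.2.le, pow_succ]
    ring
  rw [errorGain, Finset.sum_Ico_succ_top ht, Finset.sum_congr rfl h, ← Finset.mul_sum, errorGain,
    zeta_succ Lf Lm δ ht, mul_div_assoc, div_self hz, Nat.add_sub_cancel_left]
  ring

theorem errorGain_nonneg {lam β Lf Lm δ : ℝ} (hLf : 0 ≤ Lf) (hLm : 0 ≤ Lm) (hδ : 0 ≤ δ)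
    (hlam : 0 < lam) (hβ : 0 < β) (t : ℕ) : 0 ≤ errorGain lam β Lf Lm δ t := by
  have h0 : 0 ≤ eta β lam := by rw [eta]; positivity
  have hz (t : ℕ) : 0 ≤ zeta Lf Lm δ t := zero_le_one.trans (one_le_zeta hLf hLm hδ t)
  exact mul_nonneg (by positivity) (Finset.sum_nonneg fun τ _ =>
    mul_nonneg (div_nonneg (hz _) (hz _)) (pow_nonneg h0 _))

theorem Delta_eq (n : ℕ) (lam β Lf Lm δ : ℝ) (T : ℕ) :
    Delta n lam β Lf Lm δ T = n / lam * (1 + errorGain lam β Lf Lm δ T * β) := by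
  rw [Delta, errorGain]; ring

end Constants

/-! ### Finiteness of the levels and reachability of their nodes. -/

section ReachableNodes

variable {X U : Type*} {n m : ℕ} (S : SensingModel X U n m)

theorem SensingModel.node_congr (root : Node X n) {σ σ' : ℕ → U} :
    ∀ t, (∀ s < t, σ s = σ' s) → S.node root σ t = S.node root σ' t
  | 0, _ => rfl
  | t + 1, h => by
    rw [SensingModel.node, SensingModel.node,
      SensingModel.node_congr root t fun s hs => h s (by omega), h t (by omega)]

theorem SensingModel.expand_finite [Finite U] {N : Set (Node X n)} (hN : N.Finite) :
    (S.expand N).Finite := by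
  refine (hN.image2 S.step (Set.finite_univ (α := U))).subset ?_
  rintro q ⟨p, hp, u, rfl⟩
  exact ⟨p, hp, u, trivial, rfl⟩

variable [MetricSpace X] {S} {root : Node X n} {T : ℕ} {ε δ : ℝ} {L : ℕ → Set (Node X n)}

theorem IsReducedTree.finite [Finite U] (h : IsReducedTree S root T ε δ L) :
    ∀ t ≤ T, (L t).Finite
  | 0, _ => by rw [h.1]; exact Set.finite_singleton _
  | t + 1, ht => (S.expand_finite (h.finite t (by omega))).subset (h.2 t ht).1

theorem IsReducedTree.exists_node [Nonempty U] (h : IsReducedTree S root T ε δ L) :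
    ∀ t ≤ T, ∀ p ∈ L t, ∃ σ : ℕ → U, p = S.node root σ t
  | 0, _, p, hp => by
    rw [h.1] at hp
    exact ⟨fun _ => Classical.arbitrary U, hp⟩
  | t + 1, ht, p, hp => by
    obtain ⟨q, hq, u, rfl⟩ := (h.2 t ht).1 hp
    obtain ⟨σ, rfl⟩ := h.exists_node t (by omega) q hq
    refine ⟨Function.update σ t u, ?_⟩
    rw [SensingModel.node, Function.update_self,
      S.node_congr root t fun s hs => (Function.update_of_ne hs.ne u σ)]

end ReachableNodes

/-! ### Effect of one pruning and of one expansion. -/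

section ReducedTree

open scoped MatrixOrder
open Matrix

variable {X U : Type*} {n m : ℕ} (S : SensingModel X U n m)

theorem SensingModel.infoMatrix_nonneg (x : X) : 0 ≤ S.infoMatrix x := by
  have := (S.V_posDef x).inv.posSemidef.conjTranspose_mul_mul_same (S.H x)
  rw [conjTranspose_eq_transpose_of_trivial] at this
  exact Matrix.nonneg_iff_posSemidef.2 this

theorem SensingModel.W_le_riccati (x : X) {P : Matrix (Fin n) (Fin n) ℝ} (hP : 0 ≤ P) :
    S.W ≤ S.riccati x P :=
  le_add_of_nonneg_left (conj_nonneg S.A (update_nonneg hP (S.infoMatrix_nonneg x)))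

theorem SensingModel.W_nonneg : 0 ≤ S.W := Matrix.nonneg_iff_posSemidef.2 S.W_posDef.posSemidef

theorem SensingModel.node_nonneg {root : Node X n} (h : 0 ≤ root.2) (σ : ℕ → U) :
    ∀ t, 0 ≤ (S.node root σ t).2
  | 0 => h
  | t + 1 => S.W_nonneg.trans (S.W_le_riccati _ (SensingModel.node_nonneg h σ t))

theorem SensingModel.W_le_node {root : Node X n} (h : 0 ≤ root.2) (σ : ℕ → U) {t : ℕ} (ht : 1 ≤ t) :
    S.W ≤ (S.node root σ t).2 := by
  obtain ⟨t, rfl⟩ := Nat.exists_eq_add_of_le' ht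
  exact S.W_le_riccati _ (S.node_nonneg h σ t)

theorem SensingModel.lambdaW_pos (hn : 0 < n) : 0 < S.lambdaW := by
  have : Nonempty (Fin n) := ⟨⟨0, hn⟩⟩
  obtain ⟨i, hi⟩ := exists_eq_ciInf_of_finite (f := S.W_posDef.isHermitian.eigenvalues)
  rw [SensingModel.lambdaW, ← hi]
  exact S.W_posDef.eigenvalues_pos i

theorem SensingModel.lambdaW_smul_le : S.lambdaW • (1 : Matrix (Fin n) (Fin n) ℝ) ≤ S.W :=
  iInf_eigenvalues_smul_le S.W_posDef.isHermitian

variable [MetricSpace X]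

/-- Covariances of the nodes of `N` whose sensor states are within `D` of `x`. -/
def nearbyCov (N : Set (Node X n)) (x : X) (D : ℝ) : Set (Matrix (Fin n) (Fin n) ℝ) :=
  Prod.snd '' {p ∈ N | dist x p.1 ≤ D}

theorem IsPruning.exists_le {ε δ D : ℝ} (hε : 0 ≤ ε) (hδ : 0 ≤ δ) {N R : Set (Node X n)}
    (h : IsPruning ε δ N R) {x : X} {Q : Matrix (Fin n) (Fin n) ℝ}
    (hQ : Q ∈ convexHull ℝ (nearbyCov N x D)) :
    ∃ P ∈ convexHull ℝ (nearbyCov R x (D + δ)), P ≤ Q + ε • 1 := by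
  let g : Matrix (Fin n) (Fin n) ℝ →ᵃ[ℝ] Matrix (Fin n) (Fin n) ℝ :=
    AffineMap.id ℝ _ + AffineMap.const ℝ _ (ε • 1)
  refine convexHull_min ?_ (convex_exists_le (convex_convexHull ℝ (nearbyCov R x (D + δ))) g) hQ
  rintro _ ⟨p, ⟨hpN, hpD⟩, rfl⟩
  by_cases hpR : p ∈ R
  · exact ⟨p.2, subset_convexHull ℝ _ ⟨p, ⟨hpR, by linarith⟩, rfl⟩,
      le_add_of_nonneg_right (smul_psd_nonneg hε zero_le_one)⟩
  · obtain ⟨K, q, hq, α, hα, hsum, hle⟩ := h.2 p ⟨hpN, hpR⟩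
    refine ⟨∑ i, α i • (q i).2, ?_, hle⟩
    refine (convex_convexHull ℝ _).sum_mem (fun i _ => hα i) hsum fun i _ => ?_
    refine subset_convexHull ℝ _ ⟨q i, ⟨(hq i).1, ?_⟩, rfl⟩
    linarith [dist_triangle x p.1 (q i).1, (hq i).2]

/-- One expansion of a level, compared with an optimal node `(x, B)` of that level. -/
theorem exists_expand_le {Lf Lm : ℝ} (hLf : MotionContinuity S Lf) (hLm : ObservationContinuity S Lm)
    {N : Set (Node X n)} (hN : ∀ p ∈ N, 0 ≤ p.2) {x : X} {D : ℝ} (hD : 0 ≤ D)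
    {B Q : Matrix (Fin n) (Fin n) ℝ} (hB : 0 ≤ B)
    (hQ : Q ∈ convexHull ℝ (nearbyCov N x D)) {g : ℝ} (hg : 1 ≤ g) (hQB : Q ≤ g • B) (u : U) :
    ∃ P ∈ convexHull ℝ (nearbyCov (S.expand N) (S.f x u) (Lf * D)),
      P ≤ ((1 + Lm * (Lf * D)) * g) • (S.riccati (S.f x u) B - S.W) + S.W := by
  set M := S.infoMatrix (S.f x u) with hM
  have hM0 : 0 ≤ M := S.infoMatrix_nonneg _
  set G := (1 + B * M)⁻¹ * B with hG
  set c := 1 + Lm * (Lf * D) with hc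
  have hc1 : 1 ≤ c := le_add_of_nonneg_right (mul_nonneg hLm.1 (mul_nonneg hLf.1 hD))
  -- `g'` is the inflated Riccati step with the gain frozen at its value for `B`, hence affine in
  -- the covariance.
  let φ : Matrix (Fin n) (Fin n) ℝ →ₗ[ℝ] Matrix (Fin n) (Fin n) ℝ :=
    c • (LinearMap.mulLeft ℝ (S.A * (1 - G * M)) ∘ₗ LinearMap.mulRight ℝ ((1 - G * M)ᵀ * S.Aᵀ))
  let g' : Matrix (Fin n) (Fin n) ℝ →ᵃ[ℝ] Matrix (Fin n) (Fin n) ℝ :=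
    φ.toAffineMap + AffineMap.const ℝ _ (c • (S.A * (G * M * Gᵀ) * S.Aᵀ) + S.W)
  have hg' (Z) : g' Z =
      c • (S.A * ((1 - G * M) * Z * (1 - G * M)ᵀ + G * M * Gᵀ) * S.Aᵀ) + S.W := by
    simp only [g', φ, AffineMap.const_apply, LinearMap.coe_toAffineMap,
      LinearMap.smul_apply, LinearMap.comp_apply, LinearMap.mulLeft_apply,
      LinearMap.mulRight_apply, Matrix.mul_add, Matrix.add_mul, smul_add, Matrix.mul_assoc,
      Pi.add_apply, AffineMap.coe_add, add_assoc]
  have key : ∃ P ∈ convexHull ℝ (nearbyCov (S.expand N) (S.f x u) (Lf * D)), P ≤ g' Q := by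
    refine convexHull_min ?_ (convex_exists_le (convex_convexHull ℝ _) g') hQ
    rintro _ ⟨p, ⟨hpN, hpD⟩, rfl⟩
    have hdist : dist (S.f x u) (S.f p.1 u) ≤ Lf * D :=
      (hLf.2 u x p.1).trans (mul_le_mul_of_nonneg_left hpD hLf.1)
    refine ⟨(S.step p u).2, subset_convexHull ℝ _ ⟨S.step p u, ⟨⟨p, hpN, u, rfl⟩, hdist⟩, rfl⟩, ?_⟩
    rw [hg', ← Matrix.smul_mul, ← Matrix.mul_smul]
    have hM'0 := S.infoMatrix_nonneg (S.f p.1 u)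
    have hMM : M ≤ c • S.infoMatrix (S.f p.1 u) := by
      refine (Matrix.le_iff.2 (hLm.2 (S.f x u) (S.f p.1 u)).1).trans ?_
      rw [← sub_nonneg, ← sub_smul]
      refine smul_psd_nonneg (sub_nonneg.2 ?_) hM'0
      have := mul_le_mul_of_nonneg_left hdist hLm.1
      linarith
    exact add_le_add_left (conj_mono S.A (update_le_gain (hN p hpN) hM0 hM'0 hc1 hMM G)) _
  obtain ⟨P, hP, hle⟩ := key
  refine ⟨P, hP, hle.trans ?_⟩
  rw [hg']
  have h := gain_step_le hB hM0 hg (by linarith : 0 ≤ c) hQB S.A G hG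
  have e : S.riccati (S.f x u) B - S.W = S.A * G * S.Aᵀ := by
    rw [SensingModel.riccati, add_sub_cancel_right]; rfl
  rw [e]
  exact add_le_add_left h _

end ReducedTree


/-! ### Induction along the optimal trajectory. -/

section PerformanceBound

open scoped MatrixOrder
open Matrix

variable {X U : Type*} [MetricSpace X] {n m : ℕ} {S : SensingModel X U n m}

theorem IsReducedTree.cov_nonneg {root : Node X n} {T : ℕ} {ε δ : ℝ} {L : ℕ → Set (Node X n)}
    [Nonempty U] (h : IsReducedTree S root T ε δ L) (hroot : 0 ≤ root.2) {t : ℕ} (ht : t ≤ T) :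
    ∀ p ∈ L t, 0 ≤ p.2 := by
  intro p hp
  obtain ⟨σ, rfl⟩ := h.exists_node t ht p hp
  exact S.node_nonneg hroot σ t

/-- Near every optimal node, the reduced tree keeps nodes a convex combination of whose covariances
is close to the optimal covariance. -/
theorem IsReducedTree.exists_convexHull_le [Nonempty U] (hn : 0 < n) {root : Node X n}
    (hroot : 0 ≤ root.2) {T : ℕ} {ε δ : ℝ} (hε : 0 ≤ ε) (hδ : 0 ≤ δ)
    {Lf Lm : ℝ} (hLf : MotionContinuity S Lf) (hLm : ObservationContinuity S Lm) (σ : ℕ → U)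
    {β : ℝ} (hβ0 : 0 < β)
    (hβ : ∀ t ∈ Finset.Icc 1 T, (S.node root σ t).2 ≤ β • (1 : Matrix (Fin n) (Fin n) ℝ))
    {L : ℕ → Set (Node X n)} (hL : IsReducedTree S root T ε δ L) :
    ∀ t ∈ Finset.Icc 1 T, ∃ Q ∈ convexHull ℝ (nearbyCov (L t) (S.node root σ t).1
        (∑ s ∈ Finset.range t, Lf ^ s * δ)),
      Q ≤ S.W + zeta Lf Lm δ t • ((S.node root σ t).2 - S.W) +
        ε • (1 + errorGain S.lambdaW β Lf Lm δ t • (S.node root σ t).2) := by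
  have hl := S.lambdaW_pos hn
  intro t ht
  obtain ⟨ht1, htT⟩ := Finset.mem_Icc.1 ht
  clear ht
  induction t, ht1 using Nat.le_induction with
  | base =>
    -- Level `0` is unpruned, so the optimal node is present before the first pruning, at radius
    -- `0`; here `ζ_1 = 1` and `errorGain` vanishes.
    have h0 : (S.node root σ 1).2 ∈
        convexHull ℝ (nearbyCov (S.expand (L 0)) (S.node root σ 1).1 0) := by
      refine subset_convexHull ℝ _ ⟨S.node root σ 1, ⟨⟨root, ?_, σ 0, rfl⟩, by simp⟩, rfl⟩
      rw [hL.1]; rfl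
    obtain ⟨P, hP, hle⟩ := (hL.2 0 htT).exists_le hε hδ h0
    refine ⟨P, ?_, ?_⟩
    · simpa using hP
    · simpa [zeta, errorGain] using hle
  | succ t ht ih =>
    obtain ⟨Q, hQ, hQle⟩ := ih (by omega)
    set B := (S.node root σ t).2 with hB
    set x := (S.node root σ t).1 with hx
    set z := zeta Lf Lm δ t with hz
    set k := errorGain S.lambdaW β Lf Lm δ t with hk
    have hz1 : 1 ≤ z := one_le_zeta hLf.1 hLm.1 hδ t
    have hk0 : 0 ≤ k := errorGain_nonneg hLf.1 hLm.1 hδ hl hβ0 t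
    have hB0 : 0 ≤ B := S.node_nonneg hroot σ t
    have hWB : S.W ≤ B := S.W_le_node hroot σ ht
    -- The frozen-gain step needs a scalar multiple of `B`, so the fresh error `ε I` is absorbed by
    -- `I ≤ B / λ_W`. The surplus `(z - 1) W` is given away.
    have hQB : Q ≤ (z + ε * (1 / S.lambdaW + k)) • B := by
      refine hQle.trans ?_
      have h1 : S.W + z • (B - S.W) ≤ z • B := by
        have := smul_psd_nonneg (sub_nonneg.2 hz1) S.W_nonneg
        rw [← sub_nonneg]
        refine this.trans_eq ?_
        module
      have h2 : (1 : Matrix (Fin n) (Fin n) ℝ) ≤ (1 / S.lambdaW) • B := by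
        have := smul_mono (one_div_pos.2 hl).le (S.lambdaW_smul_le.trans hWB)
        rwa [smul_smul, one_div_mul_cancel hl.ne', one_smul] at this
      have h3 := smul_mono hε (add_le_add h2 (le_refl (k • B)))
      refine (add_le_add h1 h3).trans_eq ?_
      module
    have hs0 : 0 ≤ ε * (1 / S.lambdaW + k) :=
      mul_nonneg hε (add_nonneg (one_div_pos.2 hl).le hk0)
    have hD : 0 ≤ ∑ s ∈ Finset.range t, Lf ^ s * δ :=
      Finset.sum_nonneg fun s _ => mul_nonneg (pow_nonneg hLf.1 s) hδ
    obtain ⟨P, hP, hPle⟩ := exists_expand_le S hLf hLm (hL.cov_nonneg hroot (by omega)) hD hB0 hQ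
      (by linarith) hQB (σ t)
    obtain ⟨R, hR, hRle⟩ := (hL.2 t htT).exists_le hε hδ hP
    refine ⟨R, ?_, hRle.trans ?_⟩
    · rw [sum_range_pow_succ]; exact hR
    · have hB' : (S.node root σ (t + 1)).2 = S.riccati (S.f x (σ t)) B := rfl
      rw [← hB'] at hPle
      set B' := (S.node root σ (t + 1)).2
      have hη := sub_noise_le_eta hl hβ0 S.lambdaW_smul_le
        (hβ (t + 1) (Finset.mem_Icc.2 ⟨by omega, htT⟩))
      rw [zeta_succ Lf Lm δ ht, errorGain_succ hLf.1 hLm.1 hδ ht, sum_Icc_pow_eq, ← hz, ← hk]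
      set c := 1 + Lm * (Lf * ∑ s ∈ Finset.range t, Lf ^ s * δ) with hc
      have hc0 : 0 ≤ c := add_nonneg zero_le_one (mul_nonneg hLm.1 (mul_nonneg hLf.1 hD))
      have h4 := smul_mono (mul_nonneg hc0 hs0) hη
      -- Only the `ε` part is contracted by `η`; the `c * z` part stays on `B' - W`.
      have h5 : (c * (z + ε * (1 / S.lambdaW + k))) • (B' - S.W) + S.W ≤
          S.W + (c * z) • (B' - S.W) +
            (c * (ε * (1 / S.lambdaW + k))) • (eta β S.lambdaW • B') := by
        refine le_trans (le_of_eq ?_) (add_le_add_right h4 (S.W + (c * z) • (B' - S.W)))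
        module
      refine (add_le_add_left (hPle.trans h5) (ε • 1)).trans_eq ?_
      module

end PerformanceBound

end InfoAcq

/-! ### From covariances to `log det`. -/

theorem theorem4 {X U : Type*} [MetricSpace X] [Finite U] {n m : ℕ} (hn : 0 < n)
    (S : InfoAcq.SensingModel X U n m)
    (x₀ : X) (P₀ : Matrix (Fin n) (Fin n) ℝ) (hP₀ : P₀.PosSemidef)
    (T : ℕ) (hT : 1 ≤ T)
    (ε δ : ℝ) (hε : 0 ≤ ε) (hδ : 0 ≤ δ)
    (Lf Lm : ℝ) (hLf : InfoAcq.MotionContinuity S Lf) (hLm : InfoAcq.ObservationContinuity S Lm)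
    (σ : ℕ → U) (hσ : S.IsOptimal (x₀, P₀) T σ)
    (β : ℝ) (hβ : ∀ t ∈ Finset.Icc 1 T,
      (β • (1 : Matrix (Fin n) (Fin n) ℝ) - (S.node (x₀, P₀) σ t).2).PosSemidef)
    (L : ℕ → Set (InfoAcq.Node X n)) (hL : InfoAcq.IsReducedTree S (x₀, P₀) T ε δ L) :
    (∀ t ∈ Finset.Icc 1 T, 1 ≤ InfoAcq.zeta Lf Lm δ t) ∧
    InfoAcq.eta β S.lambdaW < 1 ∧
    ∃ Vεδ : ℝ, InfoAcq.IsTreeValue (L T) Vεδ ∧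
      0 ≤ Vεδ - InfoAcq.cost (S.node (x₀, P₀) σ T) ∧
      Vεδ - InfoAcq.cost (S.node (x₀, P₀) σ T) ≤
        (InfoAcq.zeta Lf Lm δ T - 1) *
            (InfoAcq.cost (S.node (x₀, P₀) σ T) - Real.log S.W.det) +
          ε * InfoAcq.Delta n S.lambdaW β Lf Lm δ T := by
  open InfoAcq Matrix MatrixOrder in
  have hU : Nonempty U := ⟨σ 0⟩
  have hl := S.lambdaW_pos hn
  have hroot : 0 ≤ ((x₀, P₀) : Node X n).2 := nonneg_iff_posSemidef.2 hP₀
  have hTmem : T ∈ Finset.Icc 1 T := Finset.mem_Icc.2 ⟨hT, le_rfl⟩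
  set B := (S.node (x₀, P₀) σ T).2 with hB
  have hWB : S.W ≤ B := S.W_le_node hroot σ hT
  have hβB : B ≤ β • (1 : Matrix (Fin n) (Fin n) ℝ) := hβ T hTmem
  have hβ0 : 0 < β := by
    have h := (Matrix.le_iff.1 ((S.lambdaW_smul_le.trans hWB).trans hβB)).diag_nonneg
      (i := ⟨0, hn⟩)
    simp only [Matrix.sub_apply, Matrix.smul_apply, one_apply_eq, smul_eq_mul, mul_one] at h
    linarith
  refine ⟨fun t _ => one_le_zeta hLf.1 hLm.1 hδ t, ?_, ?_⟩
  · rw [eta, div_lt_one (by linarith)]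
    linarith
  obtain ⟨Q, hQ, hQle⟩ := hL.exists_convexHull_le hn hroot hε hδ hLf hLm σ hβ0 hβ T hTmem
  rw [← hB] at hQle
  have hz1 : 1 ≤ zeta Lf Lm δ T := one_le_zeta hLf.1 hLm.1 hδ T
  have hk0 : 0 ≤ errorGain S.lambdaW β Lf Lm δ T := errorGain_nonneg hLf.1 hLm.1 hδ hl hβ0 T
  rw [Delta_eq]
  set z := zeta Lf Lm δ T with hz
  set k := errorGain S.lambdaW β Lf Lm δ T with hk
  have hBP : B ≤ S.W + z • (B - S.W) := by
    rw [← sub_nonneg]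
    refine (smul_psd_nonneg (sub_nonneg.2 hz1) (sub_nonneg.2 hWB)).trans_eq ?_
    module
  set P := S.W + z • (B - S.W) with hP
  have hPpos : P.PosDef := posDef_of_le S.W_posDef (hWB.trans hBP)
  have hnear : ∀ Q ∈ nearbyCov (L T) (S.node (x₀, P₀) σ T).1
      (∑ s ∈ Finset.range T, Lf ^ s * δ), Q.PosDef := by
    rintro _ ⟨p, ⟨hp, -⟩, rfl⟩
    obtain ⟨σ', rfl⟩ := hL.exists_node T le_rfl p hp
    exact posDef_of_le S.W_posDef (S.W_le_node hroot σ' hT)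
  -- The tangent is taken at `P`, the bound without its `ε` term: that term then enters linearly,
  -- and `P ≥ B ≥ W` controls `tr P⁻¹`.
  obtain ⟨_, ⟨p, ⟨hp, -⟩, rfl⟩, hplog⟩ := exists_log_det_le hnear hPpos hQ hQle
  obtain ⟨V, hV⟩ : ∃ V, IsTreeValue (L T) V := by
    obtain ⟨q, hq, hmin⟩ := Set.exists_min_image (L T) cost (hL.finite T le_rfl) ⟨p, hp⟩
    exact ⟨cost q, ⟨q, hq, rfl⟩, by rintro _ ⟨r, hr, rfl⟩; exact hmin r hr⟩
  refine ⟨V, hV, ?_, ?_⟩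
  -- Pruning creates no nodes: each leaf comes from a control sequence, so optimality of `σ`
  -- applies.
  · obtain ⟨q, hq, rfl⟩ := hV.1
    obtain ⟨σ', rfl⟩ := hL.exists_node T le_rfl q hq
    exact sub_nonneg.2 (hσ σ')
  · have h1 : V ≤ Real.log p.2.det := hV.2 ⟨p, hp, rfl⟩
    have h2 := log_det_extrapolate S.W_posDef hWB hz1
    have h3 : (P⁻¹ * (1 + k • B)).trace ≤ n / S.lambdaW * (1 + k * β) := by
      have hPi : 0 ≤ P⁻¹ := nonneg_iff_posSemidef.2 hPpos.inv.posSemidef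
      have h4 : 1 + k • B ≤ (1 + k * β) • (1 : Matrix (Fin n) (Fin n) ℝ) := by
        rw [add_smul, one_smul, mul_smul]
        exact add_le_add le_rfl (smul_mono hk0 hβB)
      refine (trace_mul_mono hPi h4).trans ?_
      rw [Matrix.mul_smul, Matrix.mul_one, trace_smul, smul_eq_mul, mul_comm]
      exact mul_le_mul_of_nonneg_right
        (trace_inv_le hl (S.lambdaW_smul_le.trans (hWB.trans hBP))) (by positivity)
    have h5 := mul_le_mul_of_nonneg_left h3 hε
    rw [add_sub_cancel_left, Matrix.mul_smul, trace_smul, smul_eq_mul] at hplog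
    have hcost : cost (S.node (x₀, P₀) σ T) = Real.log B.det := rfl
    rw [hcost]
    linarith
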